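/- Let $2\le k\le n$ be integers and let $P_n$ be the path on $n$ vertices. A $k$-coloring is any function $f:V(P_n)\to\{1,\dots,k\}$ (not necessarily a proper coloring). Its type is the tuple of cardinalities of the color classes $f^{-1}(1),\dots,f^{-1}(k)$, arranged in non-decreasing order, and its Wiener index is $$W(f)=\sum_{i=1}^k\ \sum_{\{u,v\}\subseteq f^{-1}(i),\ u\ne v} d_{P_n}(u,v),$$ where $d_{P_n}(u,v)$ is the graph distance and the inner sum runs over unordered pairs. Call $f$ a $k$-color weak maximizer of $W$ on $P_n$ if $f$ is surjective and $W(f)\ge W(f')$ for every surjective $f':V(P_n)\to\{1,\dots,k\}$ of the same type as $f$; let $\mathrm{WM}_k(P_n)$ be the set of all such $f$. Let $f\in \mathrm{WM}_k(P_n)$. Then: 1. $W(f)=\min\{W(f')\mid f'\in\mathrm{WM}_k(P_n)\}$ if and only if the numbers of vertices in any two color classes of $f$ differ by at most one; and 2. $W(f)=\max\{W(f')\mid f'\in\mathrm{WM}_k(P_n)\}$ if and only if $f$ has a color class of the largest possible size $n-(k-1)$. -/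

import Mathlib

/-- The Wiener index of a set `A` of vertices of `G`: the sum of the geodesic distances
`d_G(u,v)` over all unordered pairs `{u,v}` of distinct vertices of `A`. -/
noncomputable def wienerSet {V : Type*} [DecidableEq V] (G : SimpleGraph V) (A : Finset V) : ℕ :=
  ∑ e ∈ A.sym2 with ¬ e.IsDiag,
    Sym2.lift ⟨fun u v => G.dist u v, fun _ _ => SimpleGraph.dist_comm⟩ e

/-- The color class `f⁻¹(i)`; the colors `1, …, k` are the elements of `Fin k`. -/
def colorClass {V : Type*} [Fintype V] {k : ℕ} (f : V → Fin k) (i : Fin k) : Finset V :=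
  {v | f v = i}

/-- The type of a `k`-coloring: the sizes of the color classes in non-decreasing order. -/
def colorType {V : Type*} [Fintype V] {k : ℕ} (f : V → Fin k) : List ℕ :=
  (Multiset.map (fun i => (colorClass f i).card) Finset.univ.val).sort (· ≤ ·)

/-- The Wiener index of a `k`-coloring: the sum of the Wiener indices of its color classes. -/
noncomputable def wienerIndex {V : Type*} [Fintype V] [DecidableEq V] (G : SimpleGraph V) {k : ℕ}
    (f : V → Fin k) : ℕ :=
  ∑ i, wienerSet G (colorClass f i)

/-- `f` is a `k`-color weak maximizer of the Wiener index on `G`: it is surjective and has the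
largest Wiener index among all surjective `k`-colorings of the same type. -/
def IsWeakMaximizer {V : Type*} [Fintype V] [DecidableEq V] (G : SimpleGraph V) {k : ℕ}
    (f : V → Fin k) : Prop :=
  Function.Surjective f ∧
    ∀ f' : V → Fin k, Function.Surjective f' → colorType f' = colorType f →
      wienerIndex G f' ≤ wienerIndex G f

/-- `WM_k(G)`, the collection of `k`-color weak maximizers of the Wiener index on `G`. -/
def weakMaximizers {V : Type*} [Fintype V] [DecidableEq V] (G : SimpleGraph V) (k : ℕ) :
    Set (V → Fin k) :=
  {f | IsWeakMaximizer G f}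

/-! Each edge of a path contributes, for every color class, the product of the numbers of class
members on its two sides. For two classes of sizes `p ≤ q`, the `p + q` vertices can be
redistributed into sizes `p - 1` and `q + 1` so that no edge loses and one edge strictly gains
(`cut_le_optimalPrefix`, `exists_wienerSet_add_lt`). Unbalancing a type thus strictly raises its
maximal Wiener index, so a minimal weak maximizer is balanced and a maximal one has all classes but
one equal to singletons. Conversely, each of these two conditions determines the type, weak
maximizers of one type share one Wiener index, and extremal ones exist by finiteness. -/

open Finset SimpleGraph

/-! ### Distances in the path. -/

namespace SimpleGraph

theorem le_add_length_of_pathGraph_walk {n : ℕ} {u v : Fin n} (p : (pathGraph n).Walk u v) :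
    v.val ≤ u.val + p.length := by
  induction p with
  | nil => simp
  | cons h p ih =>
    rw [pathGraph_adj] at h
    rw [Walk.length_cons]
    omega

theorem exists_pathGraph_walk_length {n : ℕ} (d : ℕ) {u v : Fin n} (h : v.val = u.val + d) :
    ∃ p : (pathGraph n).Walk u v, p.length = d := by
  induction d generalizing u with
  | zero =>
    obtain rfl : u = v := Fin.ext (by omega)
    exact ⟨.nil, rfl⟩
  | succ d ih =>
    have hu : u.val + 1 < n := by have := v.isLt; omega
    obtain ⟨p, hp⟩ := ih (u := ⟨u.val + 1, hu⟩) (by simp only; omega)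
    exact ⟨.cons (pathGraph_adj.2 (Or.inl rfl)) p, by rw [Walk.length_cons, hp]⟩

theorem pathGraph_dist_of_le {n : ℕ} {u v : Fin n} (h : u ≤ v) :
    (pathGraph n).dist u v = v.val - u.val := by
  apply le_antisymm
  · obtain ⟨p, hp⟩ := exists_pathGraph_walk_length (u := u) (v := v) (v.val - u.val)
      (by have : u.val ≤ v.val := h
          omega)
    exact hp ▸ dist_le p
  · obtain ⟨p, hp⟩ := (pathGraph_preconnected n u v).exists_walk_length_eq_dist
    have := le_add_length_of_pathGraph_walk p
    omega

end SimpleGraph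

/-! ### Wiener index by edge cuts. -/

/-- The Wiener index of a set of vertices of a path, computed edge cut by edge cut. -/
theorem wienerSet_pathGraph {n : ℕ} (A : Finset (Fin n)) :
    wienerSet (pathGraph n) A =
      ∑ t ∈ range n, #{u ∈ A | u.val < t} * #{u ∈ A | ¬ u.val < t} := by
  -- The cut before vertex `t` separates `u < v` exactly when `u < t ≤ v`; `t = 0` contributes
  -- nothing.
  have hd (u v : Fin n) (h : u < v) : (pathGraph n).dist u v =
      ∑ t ∈ range n, if u.val < t ∧ ¬ v.val < t then 1 else 0 := by
    rw [pathGraph_dist_of_le h.le, ← Finset.card_filter, ← Nat.card_Ioc]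
    congr 1
    ext t
    have := v.isLt
    simp only [mem_Ioc, mem_filter, mem_range]
    omega
  unfold wienerSet
  rw [sum_sym2_filter_not_isDiag]
  simp only [Sym2.lift_mk]
  rw [sum_congr rfl fun e he => hd e.1 e.2 (mem_filter.1 he).2, sum_comm]
  refine sum_congr rfl fun t _ => ?_
  rw [← Finset.card_filter, ← card_product]
  congr 1
  ext ⟨u, v⟩
  simp only [mem_filter, mem_offDiag, mem_product, Fin.lt_def, ne_eq, Fin.ext_iff]
  constructor
  · rintro ⟨⟨⟨h1, h2, h3⟩, h4⟩, h5, h6⟩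
    exact ⟨⟨h1, h5⟩, h2, h6⟩
  · rintro ⟨⟨h1, h5⟩, h2, h6⟩
    exact ⟨⟨⟨h1, h2, by omega⟩, by omega⟩, h5, h6⟩

theorem card_filter_val_lt_succ {n : ℕ} (A : Finset (Fin n)) {t : ℕ} (ht : t < n) :
    #{u ∈ A | u.val < t + 1} = #{u ∈ A | u.val < t} + if ⟨t, ht⟩ ∈ A then 1 else 0 := by
  have h : {u ∈ A | u.val < t + 1} = {u ∈ A | u.val < t} ∪ {u ∈ A | u = ⟨t, ht⟩} := by
    ext u
    simp only [mem_filter, mem_union, Fin.ext_iff, ← and_or_left]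
    exact and_congr_right fun _ => by omega
  rw [h, card_union_of_disjoint, filter_eq']
  · split_ifs <;> simp
  · rw [disjoint_filter]
    rintro u - h rfl
    simp at h

/-- A subset of `X` can be prescribed by its number of elements among the first `s` elements of
`X`, as a function of `s` with increments `0` and `1`. -/
theorem exists_subset_card_prefix {n : ℕ} (X : Finset (Fin n)) (g : ℕ → ℕ) (h0 : g 0 = 0)
    (hle : ∀ t, g t ≤ g (t + 1)) (hge : ∀ t, g (t + 1) ≤ g t + 1) :
    ∃ A ⊆ X, ∀ t ≤ n, #{u ∈ A | u.val < t} = g #{u ∈ X | u.val < t} := by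
  -- A vertex of `X` is selected exactly when `g` increases at its rank in `X`.
  refine ⟨{u ∈ X | g (#{x ∈ X | x.val < u.val} + 1) = g #{x ∈ X | x.val < u.val} + 1},
    filter_subset _ _, fun t => ?_⟩
  induction t with
  | zero => simp [h0]
  | succ t ih =>
    intro ht
    rw [card_filter_val_lt_succ _ ht, card_filter_val_lt_succ _ ht, ih (by omega)]
    have h1 := hle #{x ∈ X | x.val < t}
    have h2 := hge #{x ∈ X | x.val < t}
    simp only [mem_filter]
    by_cases hX : (⟨t, ht⟩ : Fin n) ∈ X
    · simp only [hX, true_and, if_true]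
      split_ifs <;> omega
    · simp [hX]

/-! ### Unbalancing two classes. -/

/-- The number of vertices of the smaller class among the first `t` vertices of two classes, in an
arrangement of classes of sizes `m ≤ m + D` of maximal Wiener index. -/
def optimalPrefix (m D t : ℕ) : ℕ := min m ((2 * t + 2 - D) / 4)

/-- With `t` vertices before the cut, `c` of them in the smaller class, the cut value is a concave
quadratic in `c` with vertex at `(2t - D)/4`; `optimalPrefix` rounds this to a nearest integer and
clamps it to `[0, m]`. -/
theorem cut_le_optimalPrefix (m D a b : ℕ) (hD : 2 ≤ D) (ha : a ≤ m + 1) (hb : b + 1 ≤ m + D) :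
    (a * (m + 1 - a) + b * (m + D - 1 - b) : ℤ) ≤
      optimalPrefix m D (a + b) * (m - optimalPrefix m D (a + b)) +
      (a + b - optimalPrefix m D (a + b)) * (m + D - (a + b - optimalPrefix m D (a + b))) := by
  set c := optimalPrefix m D (a + b) with hc
  -- Completing the squares on both sides; the constant terms differ by `(D - 1)/2`, and everything
  -- is scaled by 8.
  have key : (4 * c - 2 * (a + b) + D : ℤ) ^ 2 ≤ (4 * a - 2 * (a + b) + D - 2 : ℤ) ^ 2 +
      4 * D - 4 := by
    unfold optimalPrefix at hc
    set v' : ℤ := 4 * c - 2 * (a + b) + D with hv'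
    set v : ℤ := 4 * a - 2 * (a + b) + D - 2 with hv
    -- Rounding gives `|v'| ≤ 2`, and then `4 ≤ 4D - 4` suffices. Otherwise `c` is clamped at `0` or
    -- at `m`, so `2 < |v'| ≤ D` and `|v| ≥ |v'| - 2`.
    have h2 : v' ≤ 2 ∨ (2 < v' ∧ v' - 2 ≤ v ∧ v' ≤ D) := by omega
    have h3 : -2 ≤ v' ∨ (v' < -2 ∧ v ≤ v' + 2 ∧ -D ≤ v') := by omega
    rcases h2 with h2 | ⟨h2, h4, h5⟩
    · rcases h3 with h3 | ⟨h3, h4, h5⟩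
      · nlinarith
      · nlinarith
    · nlinarith
  nlinarith [key]

theorem mem_colorClass {V : Type*} [Fintype V] {k : ℕ} {f : V → Fin k} {i : Fin k} {v : V} :
    v ∈ colorClass f i ↔ f v = i := by
  simp [colorClass]

theorem disjoint_colorClass {V : Type*} [Fintype V] {k : ℕ} (f : V → Fin k) {i j : Fin k}
    (hij : i ≠ j) : Disjoint (colorClass f i) (colorClass f j) := by
  classical
  rw [Finset.disjoint_left]
  intro v hi hj
  rw [mem_colorClass] at hi hj
  exact hij (hi.symm.trans hj)

/-- Two disjoint vertex sets of a path can be rearranged, making the smaller one smaller and the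
larger one larger, so that the sum of the Wiener indices strictly increases. -/
theorem exists_wienerSet_add_lt {n : ℕ} {A B : Finset (Fin n)} (hAB : Disjoint A B)
    (hA : 1 ≤ #A) (hle : #A ≤ #B) :
    ∃ A' ⊆ A ∪ B, #A' + 1 = #A ∧
      wienerSet (pathGraph n) A + wienerSet (pathGraph n) B <
        wienerSet (pathGraph n) A' + wienerSet (pathGraph n) ((A ∪ B) \ A') := by
  obtain ⟨m, hm⟩ : ∃ m, #A = m + 1 := ⟨#A - 1, by omega⟩
  obtain ⟨D, hD⟩ : ∃ D, #B + 1 = m + D := ⟨#B + 1 - m, by omega⟩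
  have hX : #(A ∪ B) = #A + #B := card_union_of_disjoint hAB
  obtain ⟨A', hsub, hpre⟩ := exists_subset_card_prefix (A ∪ B) (optimalPrefix m D)
    (by unfold optimalPrefix; omega) (fun t => by unfold optimalPrefix; omega)
    (fun t => by unfold optimalPrefix; omega)
  have hall (S : Finset (Fin n)) : #{u ∈ S | u.val < n} = #S := by
    rw [filter_true_of_mem fun u _ => u.isLt]
  have hA' : #A' = m := by
    have := hpre n le_rfl
    rw [hall, hall, hX] at this
    rw [this]
    unfold optimalPrefix
    omega
  have hB' : #((A ∪ B) \ A') = m + D := by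
    rw [card_sdiff_of_subset hsub]
    omega
  have hXt (t : ℕ) : #{u ∈ A ∪ B | u.val < t} = #{u ∈ A | u.val < t} + #{u ∈ B | u.val < t} := by
    rw [filter_union, card_union_of_disjoint (disjoint_filter_filter hAB)]
  have hB't (t : ℕ) : #{u ∈ A' | u.val < t} + #{u ∈ (A ∪ B) \ A' | u.val < t} =
      #{u ∈ A ∪ B | u.val < t} := by
    rw [← card_union_of_disjoint (disjoint_filter_filter disjoint_sdiff), ← filter_union,
      union_sdiff_of_subset hsub]
  have hcompl (S : Finset (Fin n)) (t : ℕ) :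
      #{u ∈ S | u.val < t} + #{u ∈ S | ¬ u.val < t} = #S :=
    card_filter_add_card_filter_not _
  refine ⟨A', hsub, by omega, ?_⟩
  simp only [wienerSet_pathGraph, ← sum_add_distrib]
  have hcut (t : ℕ) (ht : t ≤ n) :
      #{u ∈ A | u.val < t} * #{u ∈ A | ¬ u.val < t} +
        #{u ∈ B | u.val < t} * #{u ∈ B | ¬ u.val < t} ≤
      #{u ∈ A' | u.val < t} * #{u ∈ A' | ¬ u.val < t} +
        #{u ∈ (A ∪ B) \ A' | u.val < t} * #{u ∈ (A ∪ B) \ A' | ¬ u.val < t} := by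
    have h1 := hcompl A t
    have h2 := hcompl B t
    have h3 := hcompl A' t
    have h4 := hcompl ((A ∪ B) \ A') t
    have h5 := hB't t
    have h6 := hpre t ht
    rw [hXt] at h5 h6
    have key := cut_le_optimalPrefix m D #{u ∈ A | u.val < t} #{u ∈ B | u.val < t} (by omega)
      (by omega) (by omega)
    rw [← h6] at key
    zify at *
    convert key using 3 <;> omega
  have hne : (A ∪ B).Nonempty := by
    rw [← Finset.card_pos]
    omega
  -- Strictness comes from the cut just after the first vertex of `A ∪ B`: the new arrangement gives
  -- that vertex to the larger class, whose other `m + D - 1` members lie beyond the cut.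
  have hfirst : #{u ∈ A ∪ B | u.val < ((A ∪ B).min' hne).val + 1} = 1 := by
    rw [card_eq_one]
    refine ⟨(A ∪ B).min' hne, ?_⟩
    ext u
    simp only [mem_filter, mem_singleton]
    constructor
    · rintro ⟨hu, hlt⟩
      have : ((A ∪ B).min' hne).val ≤ u.val := min'_le _ _ hu
      exact Fin.ext (by omega)
    · rintro rfl
      exact ⟨min'_mem _ _, by omega⟩
  set x := (A ∪ B).min' hne
  have hlt : x.val + 1 < n := by
    by_contra h
    have : x.val + 1 = n := by have := x.isLt; omega
    rw [this, hall] at hfirst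
    omega
  refine sum_lt_sum (fun t ht => hcut t (mem_range.1 ht).le)
    ⟨x.val + 1, mem_range.2 hlt, ?_⟩
  have h1 := hcompl A (x.val + 1)
  have h2 := hcompl B (x.val + 1)
  have h3 := hcompl A' (x.val + 1)
  have h4 := hcompl ((A ∪ B) \ A') (x.val + 1)
  have h5 := hB't (x.val + 1)
  have h6 := hpre (x.val + 1) hlt.le
  have h7 := hXt (x.val + 1)
  rw [hfirst] at h5 h6 h7
  have h8 : optimalPrefix m D 1 = 0 := by unfold optimalPrefix; omega
  rw [h8] at h6
  rw [h6, zero_add] at h5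
  rw [h6, h5]
  rcases Nat.eq_zero_or_pos #{u ∈ A | u.val < x.val + 1} with h | h
  · have h' : #{u ∈ B | u.val < x.val + 1} = 1 := by omega
    rw [h, h']
    omega
  · have h' : #{u ∈ A | u.val < x.val + 1} = 1 := by omega
    have h'' : #{u ∈ B | u.val < x.val + 1} = 0 := by omega
    rw [h', h'']
    omega

/-- Making a smaller color class smaller and a larger one larger can strictly increase the Wiener
index of a coloring of a path. -/
theorem exists_wienerIndex_lt {n k : ℕ} (f : Fin n → Fin k) {i j : Fin k} (hij : i ≠ j)
    (hi : 1 ≤ #(colorClass f i)) (hle : #(colorClass f i) ≤ #(colorClass f j)) :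
    ∃ f' : Fin n → Fin k, #(colorClass f' i) + 1 = #(colorClass f i) ∧
      #(colorClass f' j) = #(colorClass f j) + 1 ∧
      (∀ l, l ≠ i → l ≠ j → #(colorClass f' l) = #(colorClass f l)) ∧
      wienerIndex (pathGraph n) f < wienerIndex (pathGraph n) f' := by
  obtain ⟨A, hsub, hA, hlt⟩ := exists_wienerSet_add_lt (disjoint_colorClass f hij) hi hle
  set X := colorClass f i ∪ colorClass f j with hX
  have hmem (v : Fin n) : v ∈ X ↔ f v = i ∨ f v = j := by
    rw [hX, mem_union, mem_colorClass, mem_colorClass]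
  let f' : Fin n → Fin k := fun v => if v ∈ X then if v ∈ A then i else j else f v
  have hi' : colorClass f' i = A := by
    ext v
    have := @hsub v
    rw [mem_colorClass]
    grind
  have hj' : colorClass f' j = X \ A := by
    ext v
    have := @hsub v
    rw [mem_colorClass, mem_sdiff]
    grind
  have hl' (l : Fin k) (h1 : l ≠ i) (h2 : l ≠ j) : colorClass f' l = colorClass f l := by
    ext v
    rw [mem_colorClass, mem_colorClass]
    grind
  have hcard : #X = #(colorClass f i) + #(colorClass f j) :=
    card_union_of_disjoint (disjoint_colorClass f hij)
  refine ⟨f', by rw [hi', hA], ?_, fun l h1 h2 => by rw [hl' l h1 h2], ?_⟩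
  · rw [hj', card_sdiff_of_subset hsub]
    omega
  · have hsplit (g : Fin n → Fin k) : wienerIndex (pathGraph n) g =
        wienerSet (pathGraph n) (colorClass g i) + wienerSet (pathGraph n) (colorClass g j) +
          ∑ l ∈ (univ.erase i).erase j, wienerSet (pathGraph n) (colorClass g l) := by
      unfold wienerIndex
      rw [← add_sum_erase univ _ (mem_univ i),
        ← add_sum_erase (univ.erase i) _ (mem_erase.2 ⟨hij.symm, mem_univ j⟩), add_assoc]
    rw [hsplit, hsplit f', hi', hj']
    refine Nat.add_lt_add_of_lt_of_le hlt (sum_congr rfl fun l hl => ?_).le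
    simp only [mem_erase, mem_univ, and_true] at hl
    rw [hl' l hl.2 hl.1]

/-! ### Types, relabelling and weak maximizers. -/

section General

variable {V : Type*} [Fintype V] {k : ℕ}

theorem surjective_iff_card_colorClass_pos {f : V → Fin k} :
    Function.Surjective f ↔ ∀ i, 1 ≤ #(colorClass f i) := by
  refine forall_congr' fun i => ?_
  rw [Nat.one_le_iff_ne_zero, ← Nat.pos_iff_ne_zero, Finset.card_pos]
  exact exists_congr fun v => mem_colorClass.symm

theorem sum_card_colorClass (f : V → Fin k) : ∑ i, #(colorClass f i) = Fintype.card V := by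
  classical
  exact (card_eq_sum_card_fiberwise fun v _ => mem_univ (f v)).symm

theorem colorType_eq_iff {f g : V → Fin k} :
    colorType f = colorType g ↔
      Multiset.map (fun i => #(colorClass f i)) univ.val =
        Multiset.map (fun i => #(colorClass g i)) univ.val := by
  unfold colorType
  refine ⟨fun h => ?_, fun h => by rw [h]⟩
  rw [← Multiset.sort_eq (Multiset.map (fun i => #(colorClass f i)) univ.val) (· ≤ ·), h,
    Multiset.sort_eq]

theorem colorType_congr {f g : V → Fin k} (h : ∀ i, #(colorClass f i) = #(colorClass g i)) :
    colorType f = colorType g :=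
  colorType_eq_iff.2 (Multiset.map_congr rfl fun i _ => h i)

/-- Equal multisets give fibers of equal size over each value; bijections between the fibers glue to
a permutation. -/
theorem exists_perm_of_map_univ_eq {ι α : Type*} [Fintype ι] [DecidableEq α] {a b : ι → α}
    (h : Multiset.map a univ.val = Multiset.map b univ.val) :
    ∃ σ : Equiv.Perm ι, ∀ i, b (σ i) = a i := by
  have hc (c : α) : Nonempty ({i // a i = c} ≃ {i // b i = c}) := by
    refine ⟨Fintype.equivOfCardEq ?_⟩
    have := congrArg (Multiset.count c) h
    rw [Multiset.count_map, Multiset.count_map] at this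
    rw [Fintype.card_subtype, Fintype.card_subtype]
    simpa only [Finset.card, Finset.filter_val, eq_comm] using this
  exact ⟨Equiv.ofFiberEquiv fun c => (hc c).some, Equiv.ofFiberEquiv_map _⟩

theorem exists_perm_of_colorType_eq {f g : V → Fin k} (h : colorType f = colorType g) :
    ∃ σ : Equiv.Perm (Fin k), ∀ i, #(colorClass g (σ i)) = #(colorClass f i) :=
  exists_perm_of_map_univ_eq (colorType_eq_iff.1 h)

theorem colorClass_perm_comp (g : V → Fin k) (σ : Equiv.Perm (Fin k)) (i : Fin k) :
    colorClass (fun v => σ.symm (g v)) i = colorClass g (σ i) := by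
  ext v
  rw [mem_colorClass, mem_colorClass, Equiv.symm_apply_eq]

variable [DecidableEq V] {G : SimpleGraph V}

theorem wienerIndex_perm_comp (g : V → Fin k) (σ : Equiv.Perm (Fin k)) :
    wienerIndex G (fun v => σ.symm (g v)) = wienerIndex G g := by
  unfold wienerIndex
  simp only [colorClass_perm_comp]
  exact Equiv.sum_comp σ fun i => wienerSet G (colorClass g i)

theorem exists_isWeakMaximizer {h : V → Fin k} (hh : Function.Surjective h) :
    ∃ g : V → Fin k, IsWeakMaximizer G g ∧ colorType g = colorType h ∧
      wienerIndex G h ≤ wienerIndex G g := by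
  obtain ⟨g, ⟨hg, hgt⟩, hmax⟩ := Set.exists_max_image
    {g : V → Fin k | Function.Surjective g ∧ colorType g = colorType h} (wienerIndex G)
    (Set.toFinite _) ⟨h, hh, rfl⟩
  exact ⟨g, ⟨hg, fun f' hf' hft => hmax f' ⟨hf', hft.trans hgt⟩⟩, hgt, hmax h ⟨hh, rfl⟩⟩

theorem IsWeakMaximizer.wienerIndex_eq {f g : V → Fin k} (hf : IsWeakMaximizer G f)
    (hg : IsWeakMaximizer G g) (h : colorType f = colorType g) :
    wienerIndex G f = wienerIndex G g :=
  le_antisymm (hg.2 f hf.1 h) (hf.2 g hg.1 h.symm)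

theorem isLeast_wienerIndex_iff {f : V → Fin k} (hf : IsWeakMaximizer G f) :
    IsLeast {w : ℕ | ∃ f' ∈ weakMaximizers G k, w = wienerIndex G f'} (wienerIndex G f) ↔
      ∀ g : V → Fin k, IsWeakMaximizer G g → wienerIndex G f ≤ wienerIndex G g := by
  refine ⟨fun h g hg => h.2 ⟨g, hg, rfl⟩, fun h => ⟨⟨f, hf, rfl⟩, ?_⟩⟩
  rintro w ⟨g, hg, rfl⟩
  exact h g hg

theorem isGreatest_wienerIndex_iff {f : V → Fin k} (hf : IsWeakMaximizer G f) :
    IsGreatest {w : ℕ | ∃ f' ∈ weakMaximizers G k, w = wienerIndex G f'} (wienerIndex G f) ↔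
      ∀ g : V → Fin k, IsWeakMaximizer G g → wienerIndex G g ≤ wienerIndex G f := by
  refine ⟨fun h g hg => h.2 ⟨g, hg, rfl⟩, fun h => ⟨⟨f, hf, rfl⟩, ?_⟩⟩
  rintro w ⟨g, hg, rfl⟩
  exact h g hg

end General

/-! ### The two extreme types. -/

section Types

variable {V : Type*} [Fintype V] {k : ℕ}

theorem eq_replicate_add_replicate_succ {m : ℕ} (s : Multiset ℕ)
    (hs : ∀ x ∈ s, x = m ∨ x = m + 1) :
    ∃ a b, s = Multiset.replicate a m + Multiset.replicate b (m + 1) := by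
  induction s using Multiset.induction with
  | empty => exact ⟨0, 0, by simp⟩
  | cons x s ih =>
    obtain ⟨a, b, rfl⟩ := ih fun y hy => hs y (Multiset.mem_cons_of_mem hy)
    rcases hs x (Multiset.mem_cons_self _ _) with rfl | rfl
    · exact ⟨a + 1, b, by rw [Multiset.replicate_succ, Multiset.cons_add]⟩
    · exact ⟨a, b + 1, by rw [Multiset.replicate_succ, Multiset.add_cons]⟩

/-- The sizes of the color classes of a balanced coloring. -/
theorem map_card_colorClass_of_balanced {f : V → Fin k} (hk : 0 < k)
    (hf : ∀ i j, #(colorClass f j) ≤ #(colorClass f i) + 1) :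
    Multiset.map (fun i => #(colorClass f i)) univ.val =
      Multiset.replicate (k - Fintype.card V % k) (Fintype.card V / k) +
        Multiset.replicate (Fintype.card V % k) (Fintype.card V / k + 1) := by
  have : NeZero k := ⟨hk.ne'⟩
  obtain ⟨i, -, hi⟩ := exists_min_image univ (fun i => #(colorClass f i)) univ_nonempty
  obtain ⟨a, b, hab⟩ := eq_replicate_add_replicate_succ (m := #(colorClass f i))
    (Multiset.map (fun i => #(colorClass f i)) univ.val) (by
      intro x hx
      obtain ⟨j, -, rfl⟩ := Multiset.mem_map.1 hx
      have := hi j (mem_univ j)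
      have := hf i j
      omega)
  have hcard := congrArg Multiset.card hab
  have hsum := congrArg Multiset.sum hab
  -- The minimum is attained, so `b < k`; hence `b` is the remainder and the minimum the quotient of
  -- `Fintype.card V` by `k`.
  have ha : 0 < a := by
    have : #(colorClass f i) ∈ Multiset.map (fun i => #(colorClass f i)) univ.val :=
      Multiset.mem_map_of_mem _ (mem_univ i)
    rw [hab, Multiset.mem_add, Multiset.mem_replicate, Multiset.mem_replicate] at this
    omega
  have hs : (Multiset.map (fun i => #(colorClass f i)) univ.val).sum = Fintype.card V :=
    sum_card_colorClass f
  rw [hs] at hsum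
  simp only [Multiset.card_map, Finset.card_val, Finset.card_univ, Fintype.card_fin,
    Multiset.card_add, Multiset.card_replicate] at hcard
  simp only [Multiset.sum_add, Multiset.sum_replicate, smul_eq_mul] at hsum
  have hn : Fintype.card V = b + k * #(colorClass f i) := by
    nlinarith
  have hbk : b < k := by omega
  have hdiv : Fintype.card V / k = #(colorClass f i) := by
    rw [hn, Nat.add_mul_div_left _ _ hk, Nat.div_eq_of_lt hbk, zero_add]
  have hmod : Fintype.card V % k = b := by
    rw [hn, Nat.add_mul_mod_self_left, Nat.mod_eq_of_lt hbk]
  rw [hdiv, hmod, hab]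
  congr 2
  omega

/-- If the color class of `i` has the largest possible size, the other classes are singletons. -/
theorem card_colorClass_eq_one {f : V → Fin k} (hf : Function.Surjective f) {i : Fin k}
    (hi : #(colorClass f i) = Fintype.card V - (k - 1)) {j : Fin k} (hj : j ≠ i) :
    #(colorClass f j) = 1 := by
  rw [surjective_iff_card_colorClass_pos] at hf
  have hsum := sum_card_colorClass f
  rw [← add_sum_erase univ _ (mem_univ i)] at hsum
  have hle : ∑ l ∈ univ.erase i, 1 ≤ ∑ l ∈ univ.erase i, #(colorClass f l) :=
    sum_le_sum fun l _ => hf l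
  have hcard : ∑ l ∈ univ.erase i, 1 = k - 1 := by simp
  refine ((sum_eq_sum_iff_of_le fun l _ => hf l).1 ?_ j (mem_erase.2 ⟨hj, mem_univ j⟩)).symm
  have := hf i
  omega

/-- A surjective coloring without a class of the largest possible size has two classes with at
least two elements. -/
theorem exists_ne_two_le_card {f : V → Fin k} (hk : 2 ≤ k) (hf : Function.Surjective f)
    (h : ∀ i, #(colorClass f i) ≠ Fintype.card V - (k - 1)) :
    ∃ i j, i ≠ j ∧ 2 ≤ #(colorClass f i) ∧ #(colorClass f i) ≤ #(colorClass f j) := by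
  have hpos := surjective_iff_card_colorClass_pos.1 hf
  have hstep (i : Fin k) : ∃ j, j ≠ i ∧ 2 ≤ #(colorClass f j) := by
    by_contra! hcon
    apply h i
    have hsum := sum_card_colorClass f
    rw [← add_sum_erase univ _ (mem_univ i), sum_congr rfl fun l hl =>
      (show #(colorClass f l) = 1 from
        le_antisymm (Nat.le_of_lt_succ (hcon l (ne_of_mem_erase hl))) (hpos l))] at hsum
    simp at hsum
    omega
  obtain ⟨i, -, hi⟩ := hstep ⟨0, by omega⟩
  obtain ⟨j, hji, hj⟩ := hstep i
  rcases le_total #(colorClass f i) #(colorClass f j) with hle | hle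
  · exact ⟨i, j, hji.symm, hi, hle⟩
  · exact ⟨j, i, hji, hj, hle⟩

/-- One vertex can be moved from the class of `j` to the class of `i`. -/
theorem exists_move_vertex (f : V → Fin k) {i j : Fin k} (hij : i ≠ j)
    (hj : 1 ≤ #(colorClass f j)) :
    ∃ h : V → Fin k, #(colorClass h i) = #(colorClass f i) + 1 ∧
      #(colorClass h j) + 1 = #(colorClass f j) ∧
      ∀ l, l ≠ i → l ≠ j → #(colorClass h l) = #(colorClass f l) := by
  classical
  obtain ⟨v, hv⟩ := Finset.card_pos.1 hj
  have hfv := mem_colorClass.1 hv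
  refine ⟨Function.update f v i, ?_, ?_, fun l h1 h2 => ?_⟩
  · have : colorClass (Function.update f v i) i = insert v (colorClass f i) := by
      ext u
      simp only [mem_colorClass, mem_insert, Function.update_apply]
      grind
    rw [this, card_insert_of_notMem]
    rw [mem_colorClass, hfv]
    exact hij.symm
  · have : colorClass (Function.update f v i) j = (colorClass f j).erase v := by
      ext u
      simp only [mem_colorClass, mem_erase, Function.update_apply]
      grind
    rw [this, card_erase_add_one hv]
  · congr 1
    ext u
    simp only [mem_colorClass, Function.update_apply]
    grind

theorem colorType_eq_of_card_eq {f g : V → Fin k} (hf : Function.Surjective f)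
    (hg : Function.Surjective g) {i j : Fin k}
    (hi : #(colorClass f i) = Fintype.card V - (k - 1))
    (hj : #(colorClass g j) = Fintype.card V - (k - 1)) : colorType f = colorType g := by
  rw [colorType_eq_iff]
  have key {f : V → Fin k} (hf : Function.Surjective f) {i : Fin k}
      (hi : #(colorClass f i) = Fintype.card V - (k - 1)) :
      Multiset.map (fun i => #(colorClass f i)) univ.val =
        (Fintype.card V - (k - 1)) ::ₘ Multiset.replicate (k - 1) 1 := by
    rw [← Multiset.cons_erase (show i ∈ (univ : Finset (Fin k)).val from mem_univ i),
      Multiset.map_cons, hi, ← erase_val, Multiset.map_congr rfl fun l hl =>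
        card_colorClass_eq_one hf hi (ne_of_mem_erase (show l ∈ univ.erase i from hl)), Multiset.map_const']
    simp
  rw [key hf hi, key hg hj]

end Types

/-! ### Extremal weak maximizers. -/

theorem balanced_of_isLeast {n k : ℕ} {f : Fin n → Fin k} (hf : IsWeakMaximizer (pathGraph n) f)
    (hmin : ∀ g : Fin n → Fin k, IsWeakMaximizer (pathGraph n) g →
      wienerIndex (pathGraph n) f ≤ wienerIndex (pathGraph n) g) (i j : Fin k) :
    #(colorClass f j) ≤ #(colorClass f i) + 1 := by
  by_contra! hlt
  have hij : i ≠ j := by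
    rintro rfl
    omega
  have hpos := surjective_iff_card_colorClass_pos.1 hf.1
  obtain ⟨h, hhi, hhj, hhl⟩ := exists_move_vertex f hij (hpos j)
  have hsurj : Function.Surjective h := by
    rw [surjective_iff_card_colorClass_pos]
    intro l
    have := hpos l
    by_cases h1 : l = i
    · subst h1; omega
    by_cases h2 : l = j
    · subst h2; omega
    rw [hhl l h1 h2]
    exact this
  -- A best coloring `g` of the more balanced type, relabelled to have the class sizes of `h`, is
  -- unbalanced back to the sizes of `f`. This yields `W(g) < W(f') ≤ W(f)`, against minimality.
  obtain ⟨g, hg, hgt, -⟩ := exists_isWeakMaximizer (G := pathGraph n) hsurj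
  obtain ⟨σ, hσ⟩ := exists_perm_of_colorType_eq hgt.symm
  obtain ⟨f', hi', hj', hl', hW⟩ := exists_wienerIndex_lt (fun v => σ.symm (g v)) hij
    (by rw [colorClass_perm_comp, hσ]; omega)
    (by rw [colorClass_perm_comp, colorClass_perm_comp, hσ, hσ]; omega)
  simp only [colorClass_perm_comp, hσ, wienerIndex_perm_comp] at hi' hj' hl' hW
  have hcard (l : Fin k) : #(colorClass f' l) = #(colorClass f l) := by
    by_cases h1 : l = i
    · subst h1; omega
    by_cases h2 : l = j
    · subst h2; omega
    rw [hl' l h1 h2, hhl l h1 h2]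
  have hsurj' : Function.Surjective f' := by
    rw [surjective_iff_card_colorClass_pos]
    intro l
    rw [hcard]
    exact hpos l
  have h1 := hf.2 f' hsurj' (colorType_congr hcard)
  have h2 := hmin g hg
  omega

theorem exists_card_eq_of_isGreatest {n k : ℕ} (hk : 2 ≤ k) {f : Fin n → Fin k}
    (hf : IsWeakMaximizer (pathGraph n) f)
    (hmax : ∀ g : Fin n → Fin k, IsWeakMaximizer (pathGraph n) g →
      wienerIndex (pathGraph n) g ≤ wienerIndex (pathGraph n) f) :
    ∃ i, #(colorClass f i) = n - (k - 1) := by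
  by_contra! hcon
  obtain ⟨i, j, hij, hi, hle⟩ := exists_ne_two_le_card hk hf.1 (by simpa using hcon)
  obtain ⟨f', hi', hj', hl', hW⟩ := exists_wienerIndex_lt f hij (by omega) hle
  have hpos := surjective_iff_card_colorClass_pos.1 hf.1
  have hsurj : Function.Surjective f' := by
    rw [surjective_iff_card_colorClass_pos]
    intro l
    have := hpos l
    by_cases h1 : l = i
    · subst h1; omega
    by_cases h2 : l = j
    · subst h2; omega
    rw [hl' l h1 h2]
    exact this
  obtain ⟨g, hg, -, hge⟩ := exists_isWeakMaximizer (G := pathGraph n) hsurj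
  have := hmax g hg
  omega

theorem mainTheorem5 (n k : ℕ) (hk : 2 ≤ k) (hkn : k ≤ n) (f : Fin n → Fin k)
    (hf : IsWeakMaximizer (SimpleGraph.pathGraph n) f) :
    (IsLeast {w : ℕ | ∃ f' ∈ weakMaximizers (SimpleGraph.pathGraph n) k,
          w = wienerIndex (SimpleGraph.pathGraph n) f'}
        (wienerIndex (SimpleGraph.pathGraph n) f) ↔
      ∀ i j : Fin k, |((colorClass f i).card : ℤ) - ((colorClass f j).card : ℤ)| ≤ 1) ∧
    (IsGreatest {w : ℕ | ∃ f' ∈ weakMaximizers (SimpleGraph.pathGraph n) k,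
          w = wienerIndex (SimpleGraph.pathGraph n) f'}
        (wienerIndex (SimpleGraph.pathGraph n) f) ↔
      ∃ i : Fin k, (colorClass f i).card = n - (k - 1)) := by
  rw [isLeast_wienerIndex_iff hf, isGreatest_wienerIndex_iff hf]
  refine ⟨⟨fun h i j => ?_, fun h g hg => ?_⟩,
    exists_card_eq_of_isGreatest hk hf, fun ⟨i, hi⟩ g hg => ?_⟩
  · have h1 := balanced_of_isLeast hf h i j
    have h2 := balanced_of_isLeast hf h j i
    rw [abs_le]
    omega
  -- A minimizer `g₀` is balanced by the forward direction, hence has the type of `f` and the same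
  -- index; the maximum is treated likewise.
  · obtain ⟨g₀, hg₀, hmin⟩ := Set.exists_min_image (weakMaximizers (pathGraph n) k)
      (wienerIndex (pathGraph n)) (Set.toFinite _) ⟨f, hf⟩
    have hbal (i j : Fin k) : #(colorClass f j) ≤ #(colorClass f i) + 1 := by
      have := abs_le.1 (h i j)
      omega
    rw [hf.wienerIndex_eq hg₀ (colorType_eq_iff.2
      ((map_card_colorClass_of_balanced (by omega) hbal).trans
        (map_card_colorClass_of_balanced (by omega) (balanced_of_isLeast hg₀ hmin)).symm))]
    exact hmin g hg
  · obtain ⟨g₀, hg₀, hmax⟩ := Set.exists_max_image (weakMaximizers (pathGraph n) k)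
      (wienerIndex (pathGraph n)) (Set.toFinite _) ⟨f, hf⟩
    obtain ⟨j, hj⟩ := exists_card_eq_of_isGreatest hk hg₀ hmax
    rw [hf.wienerIndex_eq hg₀ (colorType_eq_of_card_eq hf.1 hg₀.1 (by simpa using hi)
      (by simpa using hj))]
    exact hmax g hg
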